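/- **Setting.** Let $\mathcal L$ be a set of labels. A (labelled) discrete-time Markov chain consists of a countable set of states $\mathcal Q$, a function $\Pr:\mathcal Q^2\to[0,1]$ with $\sum_{q'\in\mathcal Q}\Pr(q,q')=1$ for every $q$, and a labelling $\ell:\mathcal Q\to\mathcal P(\mathcal L)$. For $Q\subseteq\mathcal Q$ write $\Pr(q,Q)=\sum_{q'\in Q}\Pr(q,q')$. A trace is an infinite sequence $t=t(0)t(1)\cdots$ of states, and $\mathrm{Tr}(q)$ is the set of traces with $t(0)=q$. The chain induces a probability measure on the $\sigma$-algebra generated by the cylinders of traces starting from $q$: the cylinder of $q_0\cdots q_{m-1}$ with $q_0=q$ has probability $\prod_{i=0}^{m-2}\Pr(q_i,q_{i+1})$. **Formulae.** PCTL state formulae $\phi$ and path formulae $\psi$ are given by $$\phi::=l\mid\mathsf{true}\mid\lnot\phi\mid\phi\land\phi\mid\mathrm{Pr}_{\rhd\pi}[\psi],\qquad \psi::=\mathsf X\,\phi\mid\phi\ \mathsf U\ \phi,$$ with $l\in\mathcal L$, $\rhd\in\{>,\ge\}$ and $\pi\ge0$ real. For $\circ\in\{\mathsf X,\mathsf U\}$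 the maximum $\circ$-nesting of a formula is $0$ on $l$ and $\mathsf{true}$; it is unchanged by $\lnot$ and by $\mathrm{Pr}_{\rhd\pi}[\cdot]$; it is the maximum over the two arguments for $\land$; for $\mathsf X\,\phi$ it is that of $\phi$, plus $1$ if $\circ=\mathsf X$; for $\phi_1\,\mathsf U\,\phi_2$ it is the maximum over $\phi_1,\phi_2$, plus $1$ if $\circ=\mathsf U$. **Semantics.** For $n\in\mathbb N$ (until bound), real $\delta\ge0$ (error) and $r\in\{+1,-1\}$ (direction), the set $[\![\phi]\!]^n_{\delta,r}$ of states satisfying $\phi$ and the set $[\![\psi]\!]^n_{\delta,r}$ of traces satisfying $\psi$ are defined by $$[\![l]\!]^n_{\delta,r}=\{q: l\in\ell(q)\},\quad [\![\mathsf{true}]\!]^n_{\delta,r}=\mathcal Q,\quad [\![\lnot\phi]\!]^n_{\delta,r}=\mathcal Q\setminus[\![\phi]\!]^n_{\delta,-r},\quad [\![\phi_1\land\phi_2]\!]^n_{\delta,r}=[\![\phi_1]\!]^n_{\delta,r}\cap[\![\phi_2]\!]^n_{\delta,r},$$ $$[\![\mathrm{Pr}_{\rhd\pi}[\psi]]\!]^n_{\delta,r}=\{q:\Pr(\mathrm{Tr}(q)\cap[\![\psi]\!]^n_{\delta,r})+r\cdot\delta\rhd\pi\},\qquad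 [\![\mathsf X\,\phi]\!]^n_{\delta,r}=\{t:t(1)\in[\![\phi]\!]^n_{\delta,r}\},$$ $$[\![\phi_1\,\mathsf U\,\phi_2]\!]^n_{\delta,r}=\{t:\exists i\in\{0,\dots,n\},\ t(i)\in[\![\phi_2]\!]^n_{\delta,r}\ \wedge\ \forall j<i,\ t(j)\in[\![\phi_1]\!]^n_{\delta,r}\}.$$ **Bisimilarity.** For real $\delta\ge0$ the relation $q\sim^n_\delta q'$ is defined by recursion on $n$: $q\sim^0_\delta q'$ always holds; $q\sim^{n+1}_\delta q'$ holds iff for all $Q\subseteq\mathcal Q$ one has $\ell(q)=\ell(q')$, $\Pr(q,Q)\le\Pr(q',R^n_\delta(Q))+\delta$ and $\Pr(q',Q)\le\Pr(q,R^n_\delta(Q))+\delta$, where $R^n_\delta(Q)=\{y:\exists x\in Q,\ x\sim^n_\delta y\}$. **Theorem (Soundness).** Let $\phi$ be a PCTL state formula with maximum $\mathsf X$-nesting $k_X$ and maximum $\mathsf U$-nesting $k_U$. For all $n\in\mathbb N$ and all real $\delta,\delta'\ge0$, with $\bar n=n\cdot k_U+k_X+1$: 1. $R^{\bar n}_\delta\big([\![\phi]\!]^n_{\delta',+1}\big)\subseteq[\![\phi]\!]^n_{\bar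 n\cdot\delta+\delta',+1}$; 2. $R^{\bar n}_\delta\big(\mathcal Q\setminus[\![\phi]\!]^n_{\delta',-1}\big)\subseteq\mathcal Q\setminus[\![\phi]\!]^n_{\bar n\cdot\delta+\delta',-1}$. -/

import Mathlib

open MeasureTheory ProbabilityTheory
open scoped NNReal ENNReal

universe u v

/-! ### Discrete-time Markov chains -/

/-- A labelled discrete-time Markov chain with labels in `L`: a countable set of states, a
transition probability function whose rows sum to `1` (hence with values in `[0, 1]`), and a
labelling of states by sets of labels. -/
structure DTMC (L : Type v) where
  /-- The states. -/
  State : Type u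
  countable_state : Countable State
  /-- The transition probability function. -/
  Pr : State → State → ℝ≥0
  hasSum_Pr : ∀ q, HasSum (Pr q) 1
  /-- The labelling function. -/
  lab : State → Set L

namespace DTMC

variable {L : Type v} (M : DTMC.{u, v} L)

instance instCountableState : Countable M.State := M.countable_state

/-- States carry the discrete σ-algebra. -/
instance instMeasurableSpaceState : MeasurableSpace M.State := ⊤

instance instDiscreteState : DiscreteMeasurableSpace M.State :=
  ⟨fun _ => MeasurableSpace.measurableSet_top⟩

/-- The probability `Pr(q, S)` of moving in one step from `q` into the set `S`. -/
noncomputable def prSet (q : M.State) (S : Set M.State) : ℝ≥0 := ∑' x : S, M.Pr q x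

/-- The distribution of the state reached in one step from `q`. -/
noncomputable def stepPMF (q : M.State) : PMF M.State :=
  ⟨fun x => (M.Pr q x : ℝ≥0∞), by
    have h := ENNReal.hasSum_coe.2 (M.hasSum_Pr q)
    rwa [ENNReal.coe_one] at h⟩

/-- The one-step transition kernel. -/
noncomputable def stepKernel : Kernel M.State M.State where
  toFun q := (M.stepPMF q).toMeasure
  measurable' := measurable_of_countable _

instance instIsMarkovKernelStep : IsMarkovKernel M.stepKernel :=
  ⟨fun q => PMF.toMeasure.isProbabilityMeasure (M.stepPMF q)⟩

/-- The transition kernel at time `i`, as a kernel from histories `q₀ ⋯ qᵢ`: by the Markov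
property it only looks at `qᵢ`. -/
noncomputable def historyKernel (i : ℕ) : Kernel (Finset.Iic i → M.State) M.State :=
  M.stepKernel.comap (fun h => h ⟨i, Finset.mem_Iic.2 le_rfl⟩) (measurable_pi_apply _)

instance instIsMarkovKernelHistory (i : ℕ) : IsMarkovKernel (M.historyKernel i) := by
  unfold historyKernel
  infer_instance

/-- Traces: infinite sequences of states. They carry the product σ-algebra, which is the one
generated by cylinders. -/
abbrev Trace : Type u := ℕ → M.State

/-- The probability measure induced by the chain on the traces with initial state `q`
(Ionescu-Tulcea): the extension of the one-step kernels from the history of length one `q`. -/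
noncomputable def traceMeasure (q : M.State) : Measure M.Trace :=
  Kernel.traj (X := fun _ => M.State) M.historyKernel 0 (fun _ => q)

/-- The traces starting from `q`. -/
def tracesFrom (q : M.State) : Set M.Trace := {t | t 0 = q}

end DTMC

/-! ### PCTL formulae -/

/-- The comparison operators `>` and `≥` that occur in probability bounds. -/
inductive PCTL.Bound
  | gt
  | ge

/-- `b.Holds x y` is `x > y`, respectively `x ≥ y`. -/
def PCTL.Bound.Holds : PCTL.Bound → ℝ → ℝ → Prop
  | .gt, x, y => x > y
  | .ge, x, y => x ≥ y

/-- The two temporal operators `X` (next) and `U` (until). -/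
inductive PCTL.TempOp
  | X
  | U

mutual

/-- State formulae of PCTL with labels in `L`. -/
inductive PCTL.StateFormula (L : Type v) : Type v
  | label (l : L)
  | tt
  | neg (φ : PCTL.StateFormula L)
  | and (φ₁ φ₂ : PCTL.StateFormula L)
  | prob (b : PCTL.Bound) (π : ℝ≥0) (ψ : PCTL.PathFormula L)

/-- Path formulae of PCTL with labels in `L`. -/
inductive PCTL.PathFormula (L : Type v) : Type v
  | next (φ : PCTL.StateFormula L)
  | untl (φ₁ φ₂ : PCTL.StateFormula L)

end

mutual

/-- The maximum nesting of a temporal operator in a state formula. -/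
def PCTL.StateFormula.nest {L : Type v} (o : PCTL.TempOp) : PCTL.StateFormula L → ℕ
  | .label _ => 0
  | .tt => 0
  | .neg φ => φ.nest o
  | .and φ₁ φ₂ => max (φ₁.nest o) (φ₂.nest o)
  | .prob _ _ ψ => ψ.nest o

/-- The maximum nesting of a temporal operator in a path formula. -/
def PCTL.PathFormula.nest {L : Type v} (o : PCTL.TempOp) : PCTL.PathFormula L → ℕ
  | .next φ => φ.nest o + (match o with | .X => 1 | .U => 0)
  | .untl φ₁ φ₂ => max (φ₁.nest o) (φ₂.nest o) + (match o with | .X => 0 | .U => 1)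

end

/-! ### Relaxed and strengthened semantics -/

mutual

/-- The states satisfying a state formula, with until bound `n`, error `δ` and direction
`r ∈ {+1, -1}`. -/
noncomputable def DTMC.sem {L : Type v} (M : DTMC.{u, v} L) (n : ℕ) (δ : ℝ≥0) :
    ℤˣ → PCTL.StateFormula L → Set M.State
  | _, .label l => {q | l ∈ M.lab q}
  | _, .tt => Set.univ
  | r, .neg φ => (DTMC.sem M n δ (-r) φ)ᶜ
  | r, .and φ₁ φ₂ => DTMC.sem M n δ r φ₁ ∩ DTMC.sem M n δ r φ₂
  | r, .prob b π ψ =>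
      {q | b.Holds
        ((M.traceMeasure q).real (M.tracesFrom q ∩ DTMC.pathSem M n δ r ψ)
          + ((r : ℤ) : ℝ) * (δ : ℝ)) (π : ℝ)}

/-- The traces satisfying a path formula, with until bound `n`, error `δ` and direction
`r ∈ {+1, -1}`. -/
noncomputable def DTMC.pathSem {L : Type v} (M : DTMC.{u, v} L) (n : ℕ) (δ : ℝ≥0) :
    ℤˣ → PCTL.PathFormula L → Set M.Trace
  | r, .next φ => {t | t 1 ∈ DTMC.sem M n δ r φ}
  | r, .untl φ₁ φ₂ =>
      {t | ∃ i ≤ n, t i ∈ DTMC.sem M n δ r φ₂ ∧ ∀ j < i, t j ∈ DTMC.sem M n δ r φ₁}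

end

/-! ### Up-to-`n, δ` bisimilarity -/

/-- Up-to-`n, δ` bisimilarity of states, by recursion on `n`. The set
`{y | ∃ x ∈ S, M.Bisim δ n x y}` is the image of `S` under the relation at the previous level. -/
def DTMC.Bisim {L : Type v} (M : DTMC.{u, v} L) (δ : ℝ≥0) : ℕ → M.State → M.State → Prop
  | 0, _, _ => True
  | n + 1, q, q' => ∀ S : Set M.State,
      M.lab q = M.lab q' ∧
      M.prSet q S ≤ M.prSet q' {y | ∃ x ∈ S, DTMC.Bisim M δ n x y} + δ ∧
      M.prSet q' S ≤ M.prSet q {y | ∃ x ∈ S, DTMC.Bisim M δ n x y} + δ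

/-- The image of a set of states under up-to-`n, δ` bisimilarity. -/
def DTMC.bisimImage {L : Type v} (M : DTMC.{u, v} L) (n : ℕ) (δ : ℝ≥0) (S : Set M.State) :
    Set M.State :=
  {y | ∃ x ∈ S, M.Bisim δ n x y}

-- The proof is a mutual induction on state and path formulae. The induction claim covers every
-- depth `m ≥ n * k_U + k_X + 1` and every error `ε ≥ m * δ + δ'`, so subformulae can be compared at
-- whatever depth remains, and monotonicity of bisimilarity in its depth is never needed. It treats
-- both directions at once, because negation exchanges them.
--
-- At a probability operator it suffices that the path probability changes by at most `m * δ`: the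
-- widening of the error from `δ'` to `ε` absorbs this. A next operator uses one level of depth and
-- costs `δ`. A bounded until uses `n` levels and costs `n * δ`: first-step analysis turns its
-- probability into an `n`-fold integral, and each integration loses one more `δ` by the layer-cake
-- comparison below.

/-- A layer-cake comparison: if every set is `μ`-charged at most as much as its image under a
relation is `ν`-charged, up to `d`, and `f ≤ g + c` along the relation, then the integrals of
`[0, 1]`-valued functions compare up to `c + d`. -/
theorem lintegral_le_of_forall_measure_le_image {α : Type*} [MeasurableSpace α]
    [DiscreteMeasurableSpace α] (μ ν : Measure α) [IsProbabilityMeasure ν]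
    (R : α → α → Prop) (c d : ℝ≥0) (hμν : ∀ S, μ S ≤ ν {y | ∃ x ∈ S, R x y} + d)
    (f g : α → ℝ≥0∞) (hf : ∀ x, f x ≤ 1) (hg : ∀ x, g x ≤ 1)
    (hfg : ∀ x y, R x y → f x ≤ g y + c) :
    ∫⁻ x, f x ∂μ ≤ ∫⁻ y, g y ∂ν + c + d := by
  have hf_top : ∀ x, f x ≠ ∞ := fun x => ne_top_of_le_ne_top ENNReal.one_ne_top (hf x)
  have hg_top : ∀ x, g x ≠ ∞ := fun x => ne_top_of_le_ne_top ENNReal.one_ne_top (hg x)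
  have hc_top : ∀ x, g x + c ≠ ∞ := fun x => ENNReal.add_ne_top.2 ⟨hg_top x, ENNReal.coe_ne_top⟩
  have layer : ∀ (ρ : Measure α) (h : α → ℝ≥0∞), (∀ x, h x ≠ ∞) →
      ∫⁻ x, h x ∂ρ = ∫⁻ t in Set.Ioi (0 : ℝ), ρ {a | t ≤ (h a).toReal} := by
    intro ρ h hh
    rw [← lintegral_eq_lintegral_meas_le ρ (Filter.Eventually.of_forall fun _ =>
      ENNReal.toReal_nonneg) (Measurable.of_discrete).aemeasurable]
    exact lintegral_congr fun x => (ENNReal.ofReal_toReal (hh x)).symm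
  -- Since `f ≤ 1`, levels above `1` contribute nothing on the left. The defect `d` is thus paid
  -- only on `(0, 1]`, and integrates to exactly `d`.
  have level : ∀ t ∈ Set.Ioi (0 : ℝ), μ {a | t ≤ (f a).toReal} ≤
      ν {a | t ≤ (g a + c).toReal} + (Set.Ioc (0 : ℝ) 1).indicator (fun _ => (d : ℝ≥0∞)) t := by
    intro t ht
    by_cases h1 : t ≤ 1
    · rw [Set.indicator_of_mem (show t ∈ Set.Ioc (0 : ℝ) 1 from ⟨ht, h1⟩)]
      refine (hμν _).trans (add_le_add (measure_mono ?_) le_rfl)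
      rintro y ⟨x, hx, hxy⟩
      exact le_trans hx (ENNReal.toReal_mono (hc_top y) (hfg x y hxy))
    · have : {a | t ≤ (f a).toReal} = ∅ := by
        ext x
        have hx := ENNReal.toReal_mono ENNReal.one_ne_top (hf x)
        rw [ENNReal.toReal_one] at hx
        simpa using lt_of_le_of_lt hx (not_le.1 h1)
      simp [this]
  calc ∫⁻ x, f x ∂μ = ∫⁻ t in Set.Ioi (0 : ℝ), μ {a | t ≤ (f a).toReal} := layer μ f hf_top
    _ ≤ ∫⁻ t in Set.Ioi (0 : ℝ), (ν {a | t ≤ (g a + c).toReal}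
          + (Set.Ioc (0 : ℝ) 1).indicator (fun _ => (d : ℝ≥0∞)) t) :=
        setLIntegral_mono' measurableSet_Ioi level
    _ = ∫⁻ y, (g y + c) ∂ν + d := by
        rw [lintegral_add_right _ (measurable_const.indicator measurableSet_Ioc),
          ← layer ν _ hc_top, lintegral_indicator measurableSet_Ioc,
          Measure.restrict_restrict measurableSet_Ioc,
          Set.inter_eq_left.2 Set.Ioc_subset_Ioi_self]
        simp
    _ = ∫⁻ y, g y ∂ν + c + d := by
        rw [lintegral_add_right _ measurable_const]
        simp

-- Basic consequences of bisimilarity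

namespace DTMC

variable {L : Type v} (M : DTMC.{u, v} L)

theorem coe_prSet (q : M.State) (S : Set M.State) :
    (M.prSet q S : ℝ≥0∞) = M.stepKernel q S := by
  have hs : Summable fun x : S => M.Pr q x :=
    NNReal.summable_comp_injective (M.hasSum_Pr q).summable Subtype.coe_injective
  rw [prSet, ENNReal.coe_tsum hs]
  change _ = (M.stepPMF q).toMeasure S
  rw [PMF.toMeasure_apply_eq_tsum]
  exact tsum_subtype S (fun x => (M.Pr q x : ℝ≥0∞))

theorem Bisim.symm {δ : ℝ≥0} {n : ℕ} {q q' : M.State} (h : M.Bisim δ n q q') :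
    M.Bisim δ n q' q := by
  cases n with
  | zero => simp [DTMC.Bisim]
  | succ n =>
    simp only [DTMC.Bisim] at h ⊢
    exact fun S => ⟨(h S).1.symm, (h S).2.2, (h S).2.1⟩

theorem Bisim.lab_eq {δ : ℝ≥0} {n : ℕ} {q q' : M.State} (h : M.Bisim δ (n + 1) q q') :
    M.lab q = M.lab q' := by
  simp only [DTMC.Bisim] at h
  exact (h ∅).1

theorem Bisim.stepKernel_le {δ : ℝ≥0} {n : ℕ} {q q' : M.State} (h : M.Bisim δ (n + 1) q q')
    (S : Set M.State) :
    M.stepKernel q S ≤ M.stepKernel q' {y | ∃ x ∈ S, M.Bisim δ n x y} + δ := by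
  simp only [DTMC.Bisim] at h
  rw [← M.coe_prSet, ← M.coe_prSet]
  exact_mod_cast (h S).2.1

/-! ### Probabilities of path formulae -/

/-- Extending a history does not alter it: the marginal on times up to `a` is the Dirac mass at `h`.
-/
theorem ae_traj_apply_eq (a : ℕ) (h : Finset.Iic a → M.State) :
    ∀ᵐ t ∂(Kernel.traj (X := fun _ => M.State) M.historyKernel a h),
      t a = h ⟨a, Finset.mem_Iic.2 le_rfl⟩ := by
  have hm := Kernel.traj_map_frestrictLe_apply (X := fun _ => M.State)
    (κ := M.historyKernel) a a h
  rw [Kernel.partialTraj_self, Kernel.id_apply] at hm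
  have hp : ∀ᵐ x ∂(Measure.dirac h : Measure (Finset.Iic a → M.State)),
      x ⟨a, Finset.mem_Iic.2 le_rfl⟩ = h ⟨a, Finset.mem_Iic.2 le_rfl⟩ := by
    rw [ae_dirac_iff]
    exact measurable_pi_apply _ (MeasurableSet.of_discrete (s := {_}))
  rw [← hm] at hp
  exact ae_of_ae_map (by fun_prop) hp

instance instIsProbabilityMeasureTrace (q : M.State) :
    IsProbabilityMeasure (M.traceMeasure q) := by
  unfold traceMeasure
  infer_instance

theorem traceMeasure_tracesFrom_inter (q : M.State) (E : Set M.Trace) :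
    M.traceMeasure q (M.tracesFrom q ∩ E) = M.traceMeasure q E := by
  refine measure_congr ?_
  filter_upwards [M.ae_traj_apply_eq 0 (fun _ => q)] with t ht
  exact propext ⟨fun h => h.2, fun h => ⟨ht, h⟩⟩

theorem traceMeasure_next (q : M.State) (S : Set M.State) :
    M.traceMeasure q {t | t 1 ∈ S} = M.stepKernel q S := by
  have h := Kernel.map_traj_succ_self (X := fun _ => M.State) (κ := M.historyKernel) (a := 0)
  have h' := congrArg (fun κ => κ (fun _ => q) S) h
  rw [Kernel.map_apply' _ (by fun_prop) _ (MeasurableSet.of_discrete)] at h'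
  exact h'

/-- The traces which, from time `a` on, satisfy `A` until they reach `B` within `n` steps. -/
def untilSet (A B : Set M.State) (a n : ℕ) : Set M.Trace :=
  {t | ∃ i ≤ n, t (a + i) ∈ B ∧ ∀ j < i, t (a + j) ∈ A}

theorem mem_untilSet_zero {A B : Set M.State} {a : ℕ} {t : M.Trace} :
    t ∈ M.untilSet A B a 0 ↔ t a ∈ B := by
  simp [untilSet]

theorem mem_untilSet_succ {A B : Set M.State} {a n : ℕ} {t : M.Trace} :
    t ∈ M.untilSet A B a (n + 1) ↔ t a ∈ B ∨ t a ∈ A ∧ t ∈ M.untilSet A B (a + 1) n := by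
  constructor
  · rintro ⟨i, hi, hB, hA⟩
    cases i with
    | zero => exact Or.inl hB
    | succ i =>
      refine Or.inr ⟨hA 0 (Nat.succ_pos _), i, Nat.le_of_succ_le_succ hi, ?_, fun j hj => ?_⟩
      · rwa [Nat.add_assoc, Nat.add_comm 1]
      · rw [Nat.add_assoc, Nat.add_comm 1]
        exact hA (j + 1) (Nat.succ_lt_succ hj)
  · rintro (hB | ⟨hA, i, hi, hB, hA'⟩)
    · exact ⟨0, Nat.zero_le _, hB, by simp⟩
    · refine ⟨i + 1, Nat.succ_le_succ hi, ?_, fun j hj => ?_⟩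
      · rwa [Nat.add_assoc, Nat.add_comm 1] at hB
      · cases j with
        | zero => exact hA
        | succ j =>
          have := hA' j (Nat.lt_of_succ_lt_succ hj)
          rwa [Nat.add_assoc, Nat.add_comm 1] at this

theorem measurableSet_untilSet (A B : Set M.State) (a n : ℕ) :
    MeasurableSet (M.untilSet A B a n) := by
  induction n generalizing a with
  | zero =>
    have : M.untilSet A B a 0 = (fun t : M.Trace => t a) ⁻¹' B :=
      Set.ext fun t => M.mem_untilSet_zero
    rw [this]
    exact measurable_pi_apply a MeasurableSet.of_discrete
  | succ n ih =>
    have : M.untilSet A B a (n + 1) = (fun t : M.Trace => t a) ⁻¹' B ∪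
        (fun t : M.Trace => t a) ⁻¹' A ∩ M.untilSet A B (a + 1) n :=
      Set.ext fun t => M.mem_untilSet_succ
    rw [this]
    exact (measurable_pi_apply a MeasurableSet.of_discrete).union
      ((measurable_pi_apply a MeasurableSet.of_discrete).inter (ih _))

open Classical in
/-- The probability of satisfying `A` until reaching `B` within `n` steps, by first-step
analysis. -/
noncomputable def untilProb (A B : Set M.State) : ℕ → M.State → ℝ≥0∞
  | 0, q => if q ∈ B then 1 else 0
  | n + 1, q =>
    if q ∈ B then 1 else if q ∈ A then ∫⁻ x, untilProb A B n x ∂(M.stepKernel q) else 0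

theorem untilProb_le_one (A B : Set M.State) (n : ℕ) (q : M.State) :
    M.untilProb A B n q ≤ 1 := by
  induction n generalizing q with
  | zero => rw [untilProb]; split_ifs <;> simp
  | succ n ih =>
    rw [untilProb]
    split_ifs
    · exact le_rfl
    · calc _ ≤ ∫⁻ _, 1 ∂(M.stepKernel q) := lintegral_mono ih
        _ = 1 := by simp
    · exact zero_le_one

/-- The start time and the history must vary in the induction: after one step the trajectory
restarts at time `a + 1` from a longer history, of which only the last state matters. -/
theorem traj_untilSet (A B : Set M.State) (n a : ℕ) (h : Finset.Iic a → M.State) :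
    Kernel.traj (X := fun _ => M.State) M.historyKernel a h (M.untilSet A B a n) =
      M.untilProb A B n (h ⟨a, Finset.mem_Iic.2 le_rfl⟩) := by
  induction n generalizing a with
  | zero =>
    rw [untilProb]
    have hae := M.ae_traj_apply_eq a h
    split_ifs with hB
    · refine (prob_compl_eq_zero_iff (M.measurableSet_untilSet A B a 0)).1 ?_
      filter_upwards [hae] with t ht
      simpa [mem_untilSet_zero, ht] using hB
    · refine measure_eq_zero_iff_ae_notMem.2 ?_
      filter_upwards [hae] with t ht
      simpa [mem_untilSet_zero, ht] using hB
  | succ n ih =>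
    rw [untilProb]
    have hae := M.ae_traj_apply_eq a h
    split_ifs with hB hA
    · refine (prob_compl_eq_zero_iff (M.measurableSet_untilSet A B a (n + 1))).1 ?_
      filter_upwards [hae] with t ht
      exact M.mem_untilSet_succ.2 (Or.inl (ht.symm ▸ hB))
    · have hE : Kernel.traj (X := fun _ => M.State) M.historyKernel a h
          (M.untilSet A B a (n + 1)) =
          Kernel.traj (X := fun _ => M.State) M.historyKernel a h
          (M.untilSet A B (a + 1) n) := by
        refine measure_congr ?_
        filter_upwards [hae] with t ht
        refine propext (M.mem_untilSet_succ.trans ?_)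
        rw [ht]
        exact (or_iff_right hB).trans (and_iff_right hA)
      -- Condition on the history up to time `a + 1`. By induction the integrand depends only on its
      -- last state, whose law is the one-step kernel.
      rw [hE, ← Kernel.traj_comp_partialTraj (X := fun _ => M.State) (κ := M.historyKernel)
        (Nat.le_succ a), Kernel.comp_apply' _ _ _ (M.measurableSet_untilSet A B (a + 1) n)]
      simp_rw [ih]
      have hmap := Kernel.map_partialTraj_succ_self (X := fun _ => M.State)
        (κ := M.historyKernel) a
      have hlast : M.stepKernel (h ⟨a, Finset.mem_Iic.2 le_rfl⟩) = M.historyKernel a h := rfl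
      rw [hlast, ← hmap, Kernel.lintegral_map _ (by fun_prop) _ Measurable.of_discrete]
    · refine measure_eq_zero_iff_ae_notMem.2 ?_
      filter_upwards [hae] with t ht
      simp [mem_untilSet_succ, ht, hA, hB]

theorem traceMeasure_until (q : M.State) (A B : Set M.State) (n : ℕ) :
    M.traceMeasure q {t | ∃ i ≤ n, t i ∈ B ∧ ∀ j < i, t j ∈ A} = M.untilProb A B n q := by
  rw [← M.traj_untilSet A B n 0 (fun _ => q)]
  simp [untilSet, traceMeasure]

/-! ### Comparison along bisimilarity -/

theorem traceMeasure_next_le {δ : ℝ≥0} {m : ℕ} {A B : Set M.State}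
    (hAB : ∀ x y, M.Bisim δ m x y → x ∈ A → y ∈ B) {q q' : M.State}
    (h : M.Bisim δ (m + 1) q q') :
    M.traceMeasure q {t | t 1 ∈ A} ≤ M.traceMeasure q' {t | t 1 ∈ B} + δ := by
  rw [traceMeasure_next, traceMeasure_next]
  refine (h.stepKernel_le M A).trans (add_le_add (measure_mono ?_) le_rfl)
  rintro y ⟨x, hx, hxy⟩
  exact hAB x y hxy hx

/-- With `k` steps still allowed, bisimilarity of depth `m + k` is available. Each step lowers the
depth by one and adds `δ` to the error. -/
theorem untilProb_le {δ : ℝ≥0} {m n : ℕ} {A B A' B' : Set M.State}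
    (hA : ∀ k ≤ n, ∀ x y, M.Bisim δ (m + k) x y → x ∈ A → y ∈ A')
    (hB : ∀ k ≤ n, ∀ x y, M.Bisim δ (m + k) x y → x ∈ B → y ∈ B') {q q' : M.State}
    (h : M.Bisim δ (m + n) q q') :
    M.untilProb A B n q ≤ M.untilProb A' B' n q' + ((n * δ : ℝ≥0) : ℝ≥0∞) := by
  induction n generalizing q q' with
  | zero =>
    have := hB 0 le_rfl q q' h
    simp only [untilProb]
    split_ifs with h1 h2 <;> simp_all
  | succ n ih =>
    -- If `q' ∈ B'` the right side is at least `1`. Otherwise `q ∉ B`, and only `q ∈ A` needs the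
    -- integral.
    by_cases hqB' : q' ∈ B'
    · refine (M.untilProb_le_one _ _ _ _).trans ?_
      simp [untilProb, hqB']
    have hqB : q ∉ B := fun hq => hqB' (hB _ le_rfl q q' h hq)
    by_cases hqA : q ∈ A
    · have hqA' : q' ∈ A' := hA _ le_rfl q q' h hqA
      simp only [untilProb, hqB', hqB, hqA, hqA', if_true, if_false]
      have key := lintegral_le_of_forall_measure_le_image (M.stepKernel q) (M.stepKernel q')
        (M.Bisim δ (m + n)) (n * δ) δ (Bisim.stepKernel_le M h)
        (M.untilProb A B n) (M.untilProb A' B' n) (M.untilProb_le_one _ _ _)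
        (M.untilProb_le_one _ _ _)
        (fun x y hxy => ih (fun k hk => hA k (hk.trans n.le_succ))
          (fun k hk => hB k (hk.trans n.le_succ)) hxy)
      refine key.trans (le_of_eq ?_)
      rw [add_assoc, ← ENNReal.coe_add]
      congr 2
      push_cast
      ring
    · simp [untilProb, hqB, hqA]

end DTMC

-- Transfer of satisfaction along bisimilarity

theorem PCTL.Bound.Holds.mono {b : PCTL.Bound} {x y z : ℝ} (h : b.Holds x z) (hxy : x ≤ y) :
    b.Holds y z := by
  cases b
  · exact lt_of_lt_of_le h hxy
  · exact le_trans h hxy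

namespace DTMC

variable {L : Type v} (M : DTMC.{u, v} L)

theorem real_tracesFrom_inter_le {q q' : M.State} {E E' : Set M.Trace} {c : ℝ≥0}
    (h : M.traceMeasure q E ≤ M.traceMeasure q' E' + c) :
    (M.traceMeasure q).real (M.tracesFrom q ∩ E) ≤
      (M.traceMeasure q').real (M.tracesFrom q' ∩ E') + c := by
  rw [measureReal_def, measureReal_def, traceMeasure_tracesFrom_inter,
    traceMeasure_tracesFrom_inter]
  have := ENNReal.toReal_mono
    (ENNReal.add_ne_top.2 ⟨measure_ne_top _ _, ENNReal.coe_ne_top⟩) h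
  rwa [ENNReal.toReal_add (measure_ne_top _ _) ENNReal.coe_ne_top, ENNReal.coe_toReal] at this

mutual

/-- Relaxed satisfaction is preserved, and strengthened satisfaction reflected, by bisimilarity of
sufficient depth. -/
theorem sem_of_bisim (n : ℕ) (δ δ' : ℝ≥0) : ∀ (φ : PCTL.StateFormula L) (m : ℕ) (ε : ℝ≥0),
    n * φ.nest .U + φ.nest .X + 1 ≤ m → m * δ + δ' ≤ ε → ∀ q q', M.Bisim δ m q q' →
    (q ∈ M.sem n δ' 1 φ → q' ∈ M.sem n ε 1 φ) ∧
    (q ∈ M.sem n ε (-1) φ → q' ∈ M.sem n δ' (-1) φ)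
  | .label l, m, ε, hm, hε, q, q', h => by
    -- The `+ 1` in the depth bound matters here: depth `0` says nothing about labels.
    obtain ⟨m, rfl⟩ := Nat.exists_eq_add_one.2 (lt_of_lt_of_le (Nat.succ_pos _) hm)
    have := h.lab_eq M
    simp [sem, this]
  | .tt, m, ε, hm, hε, q, q', h => by simp [sem]
  | .neg φ, m, ε, hm, hε, q, q', h => by
    have ih := sem_of_bisim n δ δ' φ m ε (by simpa [PCTL.StateFormula.nest] using hm) hε q' q
      (h.symm M)
    simp only [sem, Set.mem_compl_iff, neg_neg]
    exact ⟨mt ih.2, mt ih.1⟩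
  | .and φ₁ φ₂, m, ε, hm, hε, q, q', h => by
    simp only [PCTL.StateFormula.nest] at hm
    have h₁ : n * φ₁.nest .U + φ₁.nest .X + 1 ≤ m := le_trans (by gcongr <;> simp) hm
    have h₂ : n * φ₂.nest .U + φ₂.nest .X + 1 ≤ m := le_trans (by gcongr <;> simp) hm
    have ih₁ := sem_of_bisim n δ δ' φ₁ m ε h₁ hε q q' h
    have ih₂ := sem_of_bisim n δ δ' φ₂ m ε h₂ hε q q' h
    simp only [sem, Set.mem_inter_iff]
    exact ⟨And.imp ih₁.1 ih₂.1, And.imp ih₁.2 ih₂.2⟩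
  | .prob b π ψ, m, ε, hm, hε, q, q', h => by
    have ih := pathSem_le_of_bisim n δ δ' ψ m ε (by simpa [PCTL.StateFormula.nest] using hm)
      hε q q' h
    have h₁ := M.real_tracesFrom_inter_le ih.1
    have h₂ := M.real_tracesFrom_inter_le ih.2
    have hε' : (m : ℝ) * δ + δ' ≤ ε := by exact_mod_cast hε
    push_cast at h₁ h₂
    simp only [sem, Set.mem_ofPred_eq]
    refine ⟨fun hq => hq.mono ?_, fun hq => hq.mono ?_⟩
    · push_cast
      linarith
    · push_cast
      linarith

/-- The probabilities of a path formula from bisimilar states compare, up to an error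
proportional to the depth of the bisimilarity. -/
theorem pathSem_le_of_bisim (n : ℕ) (δ δ' : ℝ≥0) : ∀ (ψ : PCTL.PathFormula L) (m : ℕ) (ε : ℝ≥0),
    n * ψ.nest .U + ψ.nest .X + 1 ≤ m → m * δ + δ' ≤ ε → ∀ q q', M.Bisim δ m q q' →
    (M.traceMeasure q (M.pathSem n δ' 1 ψ) ≤
      M.traceMeasure q' (M.pathSem n ε 1 ψ) + ((m * δ : ℝ≥0) : ℝ≥0∞)) ∧
    (M.traceMeasure q (M.pathSem n ε (-1) ψ) ≤
      M.traceMeasure q' (M.pathSem n δ' (-1) ψ) + ((m * δ : ℝ≥0) : ℝ≥0∞))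
  | .next φ, m, ε, hm, hε, q, q', h => by
    obtain ⟨m, rfl⟩ := Nat.exists_eq_add_one.2 (lt_of_lt_of_le (Nat.succ_pos _) hm)
    simp only [PCTL.PathFormula.nest, Nat.add_zero] at hm
    have ih := sem_of_bisim n δ δ' φ m ε (by omega)
      (le_trans (by gcongr; exact Nat.le_succ m) hε)
    have hδ : (δ : ℝ≥0∞) ≤ (((m + 1 : ℕ) * δ : ℝ≥0) : ℝ≥0∞) := by
      refine ENNReal.coe_le_coe.2 (le_mul_of_one_le_left zero_le ?_)
      exact_mod_cast Nat.succ_pos m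
    simp only [pathSem]
    exact ⟨(M.traceMeasure_next_le (fun x y hxy => (ih x y hxy).1) h).trans (by gcongr),
      (M.traceMeasure_next_le (fun x y hxy => (ih x y hxy).2) h).trans (by gcongr)⟩
  | .untl φ₁ φ₂, m, ε, hm, hε, q, q', h => by
    simp only [PCTL.PathFormula.nest, Nat.mul_add, Nat.mul_one, Nat.add_zero] at hm
    -- Reserve `n` levels for the steps of the until; the remaining depth still suffices for both
    -- arguments.
    obtain ⟨m, rfl⟩ : ∃ m', m = m' + n := ⟨m - n, by omega⟩
    have hm' : n * max (φ₁.nest .U) (φ₂.nest .U) + max (φ₁.nest .X) (φ₂.nest .X) + 1 ≤ m := by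
      omega
    have h₁ : n * φ₁.nest .U + φ₁.nest .X + 1 ≤ m := le_trans (by gcongr <;> simp) hm'
    have h₂ : n * φ₂.nest .U + φ₂.nest .X + 1 ≤ m := le_trans (by gcongr <;> simp) hm'
    have hε' : ∀ k ≤ n, ((m + k : ℕ) : ℝ≥0) * δ + δ' ≤ ε := fun k hk =>
      le_trans (by gcongr) hε
    have ih₁ := fun k hk => sem_of_bisim n δ δ' φ₁ (m + k) ε (by omega) (hε' k hk)
    have ih₂ := fun k hk => sem_of_bisim n δ δ' φ₂ (m + k) ε (by omega) (hε' k hk)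
    have hδ : ((n * δ : ℝ≥0) : ℝ≥0∞) ≤ (((m + n : ℕ) * δ : ℝ≥0) : ℝ≥0∞) := by
      refine ENNReal.coe_le_coe.2 ?_
      gcongr
      exact Nat.le_add_left n m
    simp only [pathSem, traceMeasure_until]
    exact ⟨(M.untilProb_le (fun k hk x y hxy => (ih₁ k hk x y hxy).1)
        (fun k hk x y hxy => (ih₂ k hk x y hxy).1) h).trans (by gcongr),
      (M.untilProb_le (fun k hk x y hxy => (ih₁ k hk x y hxy).2)
        (fun k hk x y hxy => (ih₂ k hk x y hxy).2) h).trans (by gcongr)⟩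

end

end DTMC

theorem theorem1 {L : Type v} (M : DTMC.{u, v} L) (φ : PCTL.StateFormula L)
    (n kX kU nbar : ℕ) (hkX : kX = φ.nest .X) (hkU : kU = φ.nest .U)
    (hnbar : nbar = n * kU + kX + 1) (δ δ' : ℝ≥0) :
    M.bisimImage nbar δ (M.sem n δ' 1 φ) ⊆ M.sem n (nbar * δ + δ') 1 φ ∧
    M.bisimImage nbar δ (M.sem n δ' (-1) φ)ᶜ ⊆ (M.sem n (nbar * δ + δ') (-1) φ)ᶜ := by
  have key := M.sem_of_bisim n δ δ' φ nbar (nbar * δ + δ') (by rw [hnbar, hkU, hkX]) le_rfl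
  constructor
  · rintro y ⟨x, hx, hxy⟩
    exact (key x y hxy).1 hx
  · rintro y ⟨x, hx, hxy⟩
    exact mt (key y x (hxy.symm M)).2 hx
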